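/- Let $\mathscr A$ be a $W^*$-algebra, that is, a $C^*$-algebra that is isometrically the dual of a Banach space, and let $\mathscr X,\mathscr Y$ be (right) Hilbert $C^*$-modules over $\mathscr A$, with $\mathscr A$-valued inner products linear in the second variable. For an element $x$ of such a module write $|x|=\langle x,x\rangle^{1/2}\in\mathscr A$ and $\|x\|=\|\langle x,x\rangle\|^{1/2}$. Assume that $\mathscr X$ and $\mathscr Y$ are full, i.e. the linear span of all $\langle x_1,x_2\rangle$ with $x_1,x_2\in\mathscr X$ is norm dense in $\mathscr A$, and likewise for $\mathscr Y$. Let $\mathscr Y'$ denote the set of all bounded $\mathscr A$-linear maps from $\mathscr Y$ to $\mathscr A$, with the operator norm, and similarly $\mathscr X'$. Assume that $\mathscr X$ is self-dual, i.e. every element of $\mathscr X'$ has the form $z\mapsto\langle x,z\rangle$ for some $x\in\mathscr X$. Let $B:\mathscr X\times\mathscr Y\to\mathscr A$ be a bounded $\mathscr A$-sesquilinear form: $B$ is linear in the second and conjugate linear in the first variable, $B(xa,yb)=a^*B(x,y)\,b$ for all $x\in\mathscr X$, $y\in\mathscr Y$, $a,b\in\mathscr A$, and there is a constant $M$ with $\|B(x,y)\|\le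 M\|x\|\,\|y\|$ for all $x\in\mathscr X$, $y\in\mathscr Y$. Suppose that there is $c>0$ such that $$|f(B(x,y))|\ \ge\ c\,f(|x|)\,f(|y|)$$ for every pure state $f$ of $\mathscr A$ and all $x\in\mathscr X$, $y\in\mathscr Y$. Then for every $\tau\in\mathscr Y'$ there is a unique $x\in\mathscr X$ such that $B(x,y)=\tau(y)$ for all $y\in\mathscr Y$, and this $x$ satisfies $\|x\|\le\|\tau\|/c$. -/

import Mathlib

open scoped ComplexOrder

/-- A right Hilbert C⋆-module over a C⋆-algebra `A`: a right `A`-module `E`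
(that is, a module over `Aᵐᵒᵖ`, with `x · a` written `MulOpposite.op a • x`) with an `A`-valued
inner product that is positive definite, `A`-linear in the second variable and conjugate symmetric,
and which is complete for the norm `‖x‖ = ‖⟪x, x⟫‖ ^ (1 / 2)`.
(The Mathlib class `CStarModule` requires `⟪x, a • y⟫ = a * ⟪x, y⟫`, so it describes left modules.)
-/
class HilbertCStarModule (A E : Type*) [CStarAlgebra A] [PartialOrder A]
    [NormedAddCommGroup E] [NormedSpace ℂ E] [Module Aᵐᵒᵖ E] extends Inner A E where
  inner_add_right : ∀ x y z : E, inner x (y + z) = inner x y + inner x z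
  inner_smul_right : ∀ (x y : E) (z : ℂ), inner x (z • y) = z • inner x y
  inner_op_smul_right : ∀ (x y : E) (a : A),
    inner x (MulOpposite.op a • y) = inner x y * a
  star_inner : ∀ x y : E, star (inner x y) = inner y x
  inner_self_nonneg : ∀ x : E, 0 ≤ inner x x
  inner_self_eq_zero : ∀ x : E, inner x x = 0 ↔ x = 0
  norm_eq_sqrt_norm_inner_self : ∀ x : E, ‖x‖ = √‖inner x x‖
  complete : CompleteSpace E

namespace HilbertCStarModule

section Module

variable (A E : Type*) [CStarAlgebra A] [PartialOrder A]
  [NormedAddCommGroup E] [NormedSpace ℂ E] [Module Aᵐᵒᵖ E]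

/-- `E′`: the bounded `A`-linear maps from `E` to `A`. The norm of such a map is its operator norm
as an element of `E →L[ℂ] A`. -/
def dual : Set (E →L[ℂ] A) :=
  {τ | ∀ (y : E) (a : A), τ (MulOpposite.op a • y) = τ y * a}

/-- `E` is self-dual: every bounded `A`-linear map `E → A` is of the form `⟪x, ·⟫`. -/
def IsSelfDual [HilbertCStarModule A E] : Prop :=
  ∀ τ ∈ dual A E, ∃ x : E, ∀ y : E, τ y = inner A x y

/-- `E` is full: the linear span of all `⟪x, y⟫` is norm dense in `A`. -/
def IsFull [HilbertCStarModule A E] : Prop :=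
  Dense (Submodule.span ℂ (Set.range fun p : E × E => inner A p.1 p.2) : Set A)

variable {E}

/-- `|x|`: the positive square root of `⟪x, x⟫`. -/
noncomputable def modulus [StarOrderedRing A] [HilbertCStarModule A E] (x : E) : A :=
  CFC.sqrt (inner A x x)

end Module

end HilbertCStarModule

/-- The states of a C⋆-algebra: positive linear functionals of norm one. -/
def stateSpace (A : Type*) [CStarAlgebra A] [PartialOrder A] : Set (StrongDual ℂ A) :=
  {f | (∀ a : A, 0 ≤ a → 0 ≤ f a) ∧ ‖f‖ = 1}

/-- The pure states of a (unital) C⋆-algebra: the extreme points of its state space. -/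
def pureStates (A : Type*) [CStarAlgebra A] [PartialOrder A] : Set (StrongDual ℂ A) :=
  Set.extremePoints ℝ (stateSpace A)

/-! Self-duality of `X` turns the form into `B x y = ⟪x, S y⟫` with `S : Y → X` an `A`-linear map,
and the theorem reduces to bijectivity of `S` together with `c ‖y‖ ≤ ‖S y‖`.

The lower bound is rigid. If `f` is pure and `f ⟪x₀, x₀⟫ > 0`, the functional `y ↦ f (B x₀ y)`
vanishes only on null vectors of `f ⟪·, ·⟫`, so the fiber of `Y` at `f` is at most one-dimensional;
the same holds for `X`. Fullness supplies such an `x₀`.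

Lower bound for `S` (`mul_norm_le_of_inner_eq`): a pure state `f` attaining the norm of `⟪y, y⟫` is
tested against an `x` with `f |x| = (f ⟪x, x⟫)^(1/2)`, which `HasRankOneFiber.exists_modulus`
constructs.

Surjectivity (`frameOperator_surjective`): fullness gives finitely many `y_p` not all null at any
state. Put `w_p = S y_p` and `V = ∑ w_p ⟪w_p, ·⟫`. On one-dimensional fibers Cauchy–Schwarz is an
equality, so `V` is bounded below and hence onto; its range lies in that of `S`. Solving `V x₀ = ∑
w_p τ(y_p)⋆` yields the representing vector, with no self-duality of `Y`. -/

/-! ### States and pure states: existence and separation. -/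

section States

variable {A : Type*} [CStarAlgebra A] [PartialOrder A] [StarOrderedRing A]

/-- The norm of a positive functional is its value at the unit. -/
theorem norm_eq_apply_one_of_map_nonneg {f : StrongDual ℂ A} (hf : ∀ a : A, 0 ≤ a → 0 ≤ f a) :
    (‖f‖ : ℂ) = f 1 := by
  set g : A →ₚ[ℂ] ℂ := PositiveLinearMap.mk₀ (f : A →ₗ[ℂ] ℂ) hf with hg
  have hgf (a : A) : g a = f a := rfl
  have h1 : 0 ≤ f 1 := hf 1 zero_le_one
  have h1' : ((f 1).re : ℂ) = f 1 := (Complex.nonneg_iff.1 h1).elim fun _ h ↦ Complex.ext rfl h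
  have hn1 : ‖f 1‖ = (f 1).re := by rw [← h1']; simpa using (Complex.nonneg_iff.1 h1).1
  have hre : 0 ≤ (f 1).re := (Complex.nonneg_iff.1 h1).1
  rcases subsingleton_or_nontrivial A with hA | hA
  · have : f = 0 := by ext a; rw [Subsingleton.elim a 0]; simp
    simp [this]
  rw [← h1']
  congr 1
  apply le_antisymm
  · refine f.opNorm_le_bound hre fun a ↦ ?_
    -- Cauchy–Schwarz in the GNS form: `|f a|² ≤ f 1 * f (a⋆ a)`, and `a⋆ a ≤ ‖a‖²`.
    have hcs := norm_inner_le_norm (𝕜 := ℂ) (g.toPreGNS 1) (g.toPreGNS a)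
    rw [PositiveLinearMap.preGNS_inner_def, PositiveLinearMap.preGNS_norm_def,
      PositiveLinearMap.preGNS_norm_def] at hcs
    simp only [PositiveLinearMap.ofPreGNS_toPreGNS, star_one, one_mul, hgf] at hcs
    have hle : (f (star a * a)).re ≤ (f 1).re * (‖a‖ ^ 2) := by
      have := (Complex.le_def.1
        (g.apply_le_of_isSelfAdjoint (star a * a) (IsSelfAdjoint.star_mul_self a))).1
      rw [hgf, hgf, CStarRing.norm_star_mul_self, Algebra.algebraMap_eq_smul_one,
        ← Complex.coe_smul, map_smul, ← pow_two, smul_eq_mul,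
        Complex.re_ofReal_mul] at this
      rwa [mul_comm]
    calc ‖f a‖ ≤ √(f 1).re * √(f (star a * a)).re := hcs
      _ ≤ √(f 1).re * √((f 1).re * (‖a‖ ^ 2)) := by gcongr
      _ = (f 1).re * ‖a‖ := by
        rw [Real.sqrt_mul hre, Real.sqrt_sq (norm_nonneg a), ← mul_assoc, Real.mul_self_sqrt hre]
  · rw [← hn1]
    simpa using f.le_opNorm 1

theorem mem_stateSpace_iff {f : StrongDual ℂ A} :
    f ∈ stateSpace A ↔ (∀ a : A, 0 ≤ a → 0 ≤ f a) ∧ f 1 = 1 := by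
  refine and_congr_right fun hf ↦ ?_
  rw [← norm_eq_apply_one_of_map_nonneg hf]
  norm_cast

/-- States detect positivity of selfadjoint elements. -/
theorem exists_mem_stateSpace_re_neg {h : A} (hh : IsSelfAdjoint h) (hneg : ¬ 0 ≤ h) :
    ∃ f ∈ stateSpace A, (f h).re < 0 := by
  obtain ⟨φ, hφ, hφh⟩ := ProperCone.hyperplane_separation_point
    (ProperCone.positive ℝ A) (x₀ := h) (by simpa using hneg)
  -- The separating `φ` is only real-linear. Composing with the real part before complexifying keeps
  -- its values on selfadjoint elements and makes them real.
  let ψ : Module.Dual ℝ A :=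
    φ.toLinearMap ∘ₗ (selfAdjoint.submodule ℝ A).subtype ∘ₗ (realPart : A →ₗ[ℝ] selfAdjoint A)
  have hψ (a : A) (ha : IsSelfAdjoint a) : ψ a = φ a := by
    change φ (realPart a : A) = φ a
    rw [ha.coe_realPart]
  let g₀ : A →ₗ[ℂ] ℂ := Module.Dual.extendRCLike ψ
  have hg₀ (a : A) (ha : IsSelfAdjoint a) : g₀ a = (φ a : ℂ) := by
    have h2 : ψ (Complex.I • a) = 0 := by
      change φ (realPart (Complex.I • a) : A) = 0
      rw [realPart_I_smul, ha.imaginaryPart]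
      simp
    have := Module.Dual.extendRCLike_apply (𝕜 := ℂ) ψ a
    simp only [RCLike.I_to_complex, h2, hψ a ha] at this
    simpa [g₀] using this
  let g : A →ₚ[ℂ] ℂ := PositiveLinearMap.mk₀ g₀ fun a ha ↦ by
    rw [hg₀ a (.of_nonneg ha)]
    exact_mod_cast hφ a (by simpa using ha)
  let f : StrongDual ℂ A := ⟨g₀, map_continuous g⟩
  have hfg (a : A) : f a = g₀ a := rfl
  have hf (a : A) (ha : 0 ≤ a) : 0 ≤ f a := g.map_nonneg ha
  have hfh : f h = (φ h : ℂ) := hg₀ h hh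
  have hf0 : 0 < ‖f‖ := by
    rw [norm_pos_iff]
    rintro h0
    rw [h0, zero_apply] at hfh
    have : φ h = 0 := by exact_mod_cast hfh.symm
    linarith
  refine ⟨((‖f‖⁻¹ : ℝ) : ℂ) • f, ⟨fun a ha ↦ ?_, ?_⟩, ?_⟩
  · rw [smul_apply, smul_eq_mul]
    refine mul_nonneg ?_ (hf a ha)
    exact_mod_cast (inv_pos.2 hf0).le
  · rw [norm_smul]
    simp [hf0.ne']
  · rw [smul_apply, hfh, smul_eq_mul, Complex.re_ofReal_mul, Complex.ofReal_re]
    exact mul_neg_of_pos_of_neg (inv_pos.2 hf0) hφh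

/-- Every selfadjoint element is bounded below by its value at some pure state. -/
theorem exists_mem_pureStates_algebraMap_le [Nontrivial A] {h : A} (hh : IsSelfAdjoint h) :
    ∃ f ∈ pureStates A, algebraMap ℝ A (f h).re ≤ h := by
  let K : Set (WeakDual ℂ A) := {φ | (∀ a : A, 0 ≤ a → 0 ≤ φ a) ∧ φ 1 = 1}
  have hKs (φ : WeakDual ℂ A) : φ ∈ K ↔ WeakDual.toStrongDual φ ∈ stateSpace A := by
    rw [mem_stateSpace_iff]; rfl
  have hKclosed : IsClosed K := by
    have : K = (⋂ a : A, ⋂ _ : 0 ≤ a, {φ : WeakDual ℂ A | 0 ≤ φ a}) ∩ {φ | φ 1 = 1} := by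
      ext φ; simp [K]
    rw [this]
    refine (isClosed_iInter fun a ↦ isClosed_iInter fun _ ↦ ?_).inter ?_
    · exact isClosed_le continuous_const (WeakDual.eval_continuous a)
    · exact isClosed_eq (WeakDual.eval_continuous 1) continuous_const
  have hKcomp : IsCompact K := by
    refine WeakDual.isCompact_of_bounded_of_closed ?_ hKclosed
    refine (Metric.isBounded_closedBall (x := (0 : StrongDual ℂ A)) (r := 1)).subset ?_
    intro f hf
    have := (hKs f).1 hf
    exact mem_closedBall_zero_iff.2 this.2.le
  have hKne : K.Nonempty := by
    obtain ⟨f, hf, -⟩ := exists_mem_stateSpace_re_neg (A := A) (h := -1)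
      (IsSelfAdjoint.one A).neg (by
        intro h
        exact one_ne_zero (le_antisymm (neg_nonneg.1 h) (zero_le_one (α := A))))
    exact ⟨StrongDual.toWeakDual f, (hKs _).2 (by simpa using hf)⟩
  let l : StrongDual ℝ (WeakDual ℂ A) :=
    { toFun := fun φ ↦ -(φ h).re
      map_add' := fun φ ψ ↦ by
        change -(φ h + ψ h).re = _
        simp [add_comm]
      map_smul' := fun r φ ↦ by
        change -(r • φ h).re = _
        simp
      cont := (Complex.continuous_re.comp (WeakDual.eval_continuous h)).neg }
  have hl (φ : WeakDual ℂ A) : l φ = -(φ h).re := rfl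
  -- The states minimizing `h` form a weak-⋆ compact exposed face; by Krein–Milman it has an extreme
  -- point, which is then extreme among all states.
  have hexp : IsExposed ℝ K {φ ∈ K | ∀ ψ ∈ K, l ψ ≤ l φ} := fun _ ↦ ⟨l, rfl⟩
  obtain ⟨φ₀, hφ₀, hmax⟩ := hKcomp.exists_isMaxOn hKne l.continuous.continuousOn
  have : LocallyConvexSpace ℝ (WeakDual ℂ A) :=
    inferInstanceAs (LocallyConvexSpace ℝ (WeakBilin (topDualPairing ℂ A)))
  obtain ⟨φ, hφ⟩ := (hexp.isCompact hKcomp).extremePoints_nonempty ⟨φ₀, hφ₀, hmax⟩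
  have hφK : φ ∈ K.extremePoints ℝ := hexp.isExtreme.extremePoints_subset_extremePoints hφ
  refine ⟨WeakDual.toStrongDual φ, ⟨(hKs φ).1 hφK.1, fun f₁ h₁ f₂ h₂ hseg ↦ ?_⟩, ?_⟩
  · exact hφK.2 (x₁ := StrongDual.toWeakDual f₁) ((hKs _).2 h₁)
      (x₂ := StrongDual.toWeakDual f₂) ((hKs _).2 h₂) hseg
  · by_contra hcon
    have hsa : IsSelfAdjoint (h - algebraMap ℝ A (φ h).re) :=
      hh.sub (IsSelfAdjoint.algebraMap A (.all _))
    obtain ⟨f, hf, hneg⟩ := exists_mem_stateSpace_re_neg hsa (fun h ↦ hcon (sub_nonneg.1 h))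
    have hle := hφ.1.2 (StrongDual.toWeakDual f) ((hKs _).2 hf)
    rw [hl, hl, neg_le_neg_iff] at hle
    rw [map_sub, Algebra.algebraMap_eq_smul_one, ← Complex.coe_smul, map_smul,
      (mem_stateSpace_iff.1 hf).2] at hneg
    have : (f h).re < (φ h).re := by simpa using hneg
    exact absurd hle (not_le.2 this)

end States

/-! ### Variance and square roots under states. -/

section StateInequalities

variable {A : Type*} [CStarAlgebra A] [PartialOrder A] [StarOrderedRing A]
  {f : StrongDual ℂ A}

theorem state_map_star (hf : f ∈ stateSpace A) (a : A) : f (star a) = star (f a) :=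
  map_star (PositiveLinearMap.mk₀ (f : A →ₗ[ℂ] ℂ) hf.1) a

theorem state_mono (hf : f ∈ stateSpace A) {a b : A} (hab : a ≤ b) : (f a).re ≤ (f b).re := by
  have := (Complex.nonneg_iff.1 (hf.1 _ (sub_nonneg.2 hab))).1
  rw [map_sub, Complex.sub_re] at this
  linarith

omit [StarOrderedRing A] in
theorem state_nonneg (hf : f ∈ stateSpace A) {a : A} (ha : 0 ≤ a) : 0 ≤ (f a).re :=
  (Complex.nonneg_iff.1 (hf.1 a ha)).1

omit [StarOrderedRing A] in
theorem state_ofReal_re (hf : f ∈ stateSpace A) {a : A} (ha : 0 ≤ a) : ((f a).re : ℂ) = f a :=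
  Complex.ext rfl (Complex.nonneg_iff.1 (hf.1 a ha)).2

omit [PartialOrder A] [StarOrderedRing A] in
theorem map_smul_real (f : StrongDual ℂ A) (r : ℝ) (a : A) : f (r • a) = r * f a := by
  rw [← Complex.coe_smul, map_smul, smul_eq_mul]

theorem state_apply_algebraMap (hf : f ∈ stateSpace A) (r : ℝ) : f (algebraMap ℝ A r) = r := by
  rw [Algebra.algebraMap_eq_smul_one, map_smul_real, (mem_stateSpace_iff.1 hf).2, mul_one]

theorem state_norm_sq_le (hf : f ∈ stateSpace A) (a : A) :
    ‖f a‖ ^ 2 ≤ (f (star a * a)).re := by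
  have h := state_nonneg hf (star_mul_self_nonneg (a - f a • (1 : A)))
  have h1 := (mem_stateSpace_iff.1 hf).2
  have hexp : star (a - f a • (1 : A)) * (a - f a • (1 : A))
      = star a * a - f a • star a - star (f a) • a + (f a * star (f a)) • (1 : A) := by
    simp only [star_sub, star_smul, star_one, sub_mul, mul_sub, smul_mul_assoc, mul_smul_comm,
      one_mul, mul_one, smul_sub, smul_smul]
    abel
  rw [hexp, map_add, map_sub, map_sub, map_smul, map_smul, map_smul, h1, state_map_star hf] at h
  have h2 : ‖f a‖ ^ 2 = (f a).re * (f a).re + (f a).im * (f a).im := by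
    rw [← Complex.normSq_eq_norm_sq, Complex.normSq_apply]
  simp at h
  nlinarith

/-- Since `(b k)⋆ (b k) ≤ ‖b‖² k⋆ k`, the left kernel of a state is a left ideal. With `k = h - r`,
zero variance lets `h` be replaced by the scalar `r` on the right inside `f`. -/
theorem state_apply_mul_eq_zero (hf : f ∈ stateSpace A) {k : A}
    (hk : (f (star k * k)).re ≤ 0) (b : A) : f (b * k) = 0 := by
  have h1 : star (b * k) * (b * k) ≤ ‖star b * b‖ • (star k * k) := by
    have := CStarAlgebra.star_left_conjugate_le_norm_smul (a := k) (b := star b * b)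
      (IsSelfAdjoint.star_mul_self b)
    simpa [mul_assoc] using this
  have h2 := (state_norm_sq_le hf (b * k)).trans (state_mono hf h1)
  rw [map_smul_real, Complex.re_ofReal_mul] at h2
  have h3 : ‖star b * b‖ * (f (star k * k)).re ≤ 0 :=
    mul_nonpos_of_nonneg_of_nonpos (norm_nonneg _) hk
  have h4 : ‖f (b * k)‖ ^ 2 = 0 := le_antisymm (h2.trans h3) (sq_nonneg _)
  simpa using h4

/-- Conjugate `a ≤ ‖a‖` by `√a`. -/
theorem sq_le_norm_smul_of_nonneg {a : A} (ha : 0 ≤ a) : a * a ≤ ‖a‖ • a := by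
  have hs := CFC.sqrt_nonneg a
  have h := CStarAlgebra.star_left_conjugate_le_norm_smul (a := CFC.sqrt a) (b := a)
    (.of_nonneg ha)
  have hss := CFC.sqrt_mul_sqrt_self a ha
  rw [(IsSelfAdjoint.of_nonneg hs).star_eq, hss] at h
  generalize CFC.sqrt a = s at *
  convert h using 1
  simp only [← hss, mul_assoc]

theorem state_eq_zero_of_sqrt_nonpos (hf : f ∈ stateSpace A) {a : A} (ha : 0 ≤ a)
    (h : (f (CFC.sqrt a)).re ≤ 0) : (f a).re = 0 := by
  have h1 := state_mono hf (sq_le_norm_smul_of_nonneg (CFC.sqrt_nonneg a))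
  rw [CFC.sqrt_mul_sqrt_self a ha, map_smul_real, Complex.re_ofReal_mul] at h1
  exact le_antisymm (h1.trans (mul_nonpos_of_nonneg_of_nonpos (norm_nonneg _) h))
    (state_nonneg hf ha)

/-- If a state has zero variance at `k ≥ 0`, its value at `√k` is the root of its value at `k`. -/
theorem state_sqrt_re_eq (hf : f ∈ stateSpace A) {k : A} (hk : 0 ≤ k) {r : ℝ} (hr : 0 < r)
    (h : (f ((k - algebraMap ℝ A (r ^ 2)) * (k - algebraMap ℝ A (r ^ 2)))).re ≤ 0) :
    (f (CFC.sqrt k)).re = r := by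
  set s := CFC.sqrt k with hs
  have hs0 : 0 ≤ s := CFC.sqrt_nonneg k
  have hss : s * s = k := CFC.sqrt_mul_sqrt_self k hk
  set ρ := algebraMap ℝ A r with hρ
  have hρs : ρ * s = s * ρ := Algebra.commutes r s
  have hρsa : IsSelfAdjoint ρ := IsSelfAdjoint.algebraMap A (.all r)
  have hssa : IsSelfAdjoint s := .of_nonneg hs0
  have hd : IsSelfAdjoint (s - ρ) := hssa.sub hρsa
  have hρ0 : 0 ≤ ρ := algebraMap_nonneg A hr.le
  have hρρ : algebraMap ℝ A (r ^ 2) = ρ * ρ := by rw [pow_two, map_mul]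
  have hcomm : Commute s ρ := hρs.symm
  -- With `s = √k`: `(k - r²)² = (s - r)(s + r)²(s - r) ≥ r² (s - r)²`, so zero variance passes from
  -- `k` to `s`.
  have hfac : (k - algebraMap ℝ A (r ^ 2)) * (k - algebraMap ℝ A (r ^ 2))
      = star (s - ρ) * ((s + ρ) * (s + ρ)) * (s - ρ) := by
    rw [hd.star_eq, hρρ, ← hss]
    have e1 : s * s - ρ * ρ = (s - ρ) * (s + ρ) := by
      rw [sub_mul, mul_add, mul_add, hρs]; abel
    have e2 : s * s - ρ * ρ = (s + ρ) * (s - ρ) := by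
      rw [add_mul, mul_sub, mul_sub, hρs]; abel
    nth_rewrite 1 [e1]
    rw [e2]
    simp only [mul_assoc]
  have hle : ρ * ρ ≤ (s + ρ) * (s + ρ) := by
    have : (s + ρ) * (s + ρ) = ρ * ρ + (s * s + (2 * r) • s) := by
      have : s * ρ = r • s := by rw [hρ, ← Algebra.commutes, Algebra.smul_def]
      rw [add_mul, mul_add, mul_add, hρs, this, two_mul, add_smul]; abel
    rw [this]
    exact le_add_of_nonneg_right
      (add_nonneg (hss ▸ hk) (smul_nonneg (by positivity) hs0))
  have hconj := star_left_conjugate_le_conjugate hle (s - ρ)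
  rw [← hfac] at hconj
  have hm := (state_mono hf hconj).trans h
  have e3 : star (s - ρ) * (ρ * ρ) * (s - ρ) = (r ^ 2) • (star (s - ρ) * (s - ρ)) := by
    rw [← hρρ, mul_assoc, ← Algebra.smul_def, mul_smul_comm]
  rw [e3, map_smul_real, Complex.re_ofReal_mul] at hm
  have h0 : ‖f (s - ρ)‖ ^ 2 ≤ 0 :=
    (state_norm_sq_le hf _).trans (nonpos_of_mul_nonpos_right hm (by positivity))
  have h1 : f (s - ρ) = 0 := by
    have : ‖f (s - ρ)‖ ^ 2 = 0 := le_antisymm h0 (sq_nonneg _)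
    simpa using this
  rw [map_sub, hρ, state_apply_algebraMap hf, sub_eq_zero] at h1
  rw [h1, Complex.ofReal_re]

/-- A state attaining the norm of `h ≥ 0` has zero variance at `h`. -/
theorem state_variance_nonpos (hf : f ∈ stateSpace A) {h : A} (hh : 0 ≤ h)
    (hfh : ‖h‖ ≤ (f h).re) :
    (f ((h - algebraMap ℝ A ‖h‖) * (h - algebraMap ℝ A ‖h‖))).re ≤ 0 := by
  have h1 := state_mono hf (sq_le_norm_smul_of_nonneg hh)
  have e : (h - algebraMap ℝ A ‖h‖) * (h - algebraMap ℝ A ‖h‖)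
      = h * h - (2 * ‖h‖) • h + algebraMap ℝ A (‖h‖ ^ 2) := by
    have e1 : algebraMap ℝ A ‖h‖ * h = ‖h‖ • h := (Algebra.smul_def _ _).symm
    have e2 : h * algebraMap ℝ A ‖h‖ = ‖h‖ • h := by rw [← Algebra.commutes, e1]
    rw [sub_mul, mul_sub, mul_sub, e1, e2, ← map_mul, pow_two, two_mul, add_smul]
    abel
  rw [e, map_add, map_sub, map_smul_real, state_apply_algebraMap hf]
  rw [map_smul_real, Complex.re_ofReal_mul] at h1
  simp only [Complex.add_re, Complex.sub_re, Complex.re_ofReal_mul, Complex.ofReal_re]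
  nlinarith [norm_nonneg h]

/-- Pure states detect positivity. -/
theorem nonneg_of_pureStates [Nontrivial A] {h : A} (hh : IsSelfAdjoint h)
    (hpos : ∀ f ∈ pureStates A, 0 ≤ (f h).re) : 0 ≤ h := by
  obtain ⟨f, hf, hle⟩ := exists_mem_pureStates_algebraMap_le hh
  exact (algebraMap_nonneg A (hpos f hf)).trans hle

/-- Pure states attain the norm of positive elements. -/
theorem exists_mem_pureStates_norm_le [Nontrivial A] {h : A} (hh : 0 ≤ h) :
    ∃ f ∈ pureStates A, ‖h‖ ≤ (f h).re := by
  -- Applied to `-h`, the lower bound reads `h ≤ f h`.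
  obtain ⟨f, hf, hle⟩ := exists_mem_pureStates_algebraMap_le (IsSelfAdjoint.of_nonneg hh).neg
  refine ⟨f, hf, ?_⟩
  have hfh := state_nonneg hf.1 hh
  rw [le_neg, map_neg, Complex.neg_re, map_neg, neg_neg] at hle
  refine (CStarAlgebra.norm_le_norm_of_nonneg_of_le hh hle).trans ?_
  rw [norm_algebraMap', Real.norm_of_nonneg hfh]

end StateInequalities

/-! ### Inner product calculus and a surjectivity criterion. -/

namespace HilbertCStarModule

section Basic

variable {A E : Type*} [CStarAlgebra A] [PartialOrder A]
  [NormedAddCommGroup E] [NormedSpace ℂ E] [Module Aᵐᵒᵖ E] [HilbertCStarModule A E]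

theorem inner_zero_right (x : E) : inner A x (0 : E) = 0 := by
  simpa using inner_smul_right (A := A) x (0 : E) 0

theorem inner_neg_right (x y : E) : inner A x (-y) = -inner A x y := by
  simpa using inner_smul_right (A := A) x y (-1)

theorem inner_sub_right (x y z : E) : inner A x (y - z) = inner A x y - inner A x z := by
  rw [sub_eq_add_neg, inner_add_right, inner_neg_right, sub_eq_add_neg]

theorem inner_smul_real_right (x y : E) (r : ℝ) : inner A x (r • y) = r • inner A x y := by
  rw [← Complex.coe_smul, inner_smul_right, Complex.coe_smul]

theorem inner_sum_right {ι : Type*} (s : Finset ι) (x : E) (y : ι → E) :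
    inner A x (∑ i ∈ s, y i) = ∑ i ∈ s, inner A x (y i) :=
  map_sum (AddMonoidHom.mk' (inner A x) (inner_add_right x)) y s

theorem inner_zero_left (x : E) : inner A (0 : E) x = 0 := by
  rw [← star_inner, inner_zero_right, star_zero]

theorem inner_sub_left (x y z : E) : inner A (x - y) z = inner A x z - inner A y z := by
  rw [← star_inner, inner_sub_right, star_sub, star_inner, star_inner]

theorem inner_smul_real_left (x y : E) (r : ℝ) : inner A (r • x) y = r • inner A x y := by
  rw [← star_inner, inner_smul_real_right, star_smul, star_inner, star_trivial]

theorem inner_op_smul_left (x y : E) (a : A) :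
    inner A (MulOpposite.op a • x) y = star a * inner A x y := by
  rw [← star_inner, inner_op_smul_right, star_mul, star_inner]

theorem inner_sum_left {ι : Type*} (s : Finset ι) (x : E) (y : ι → E) :
    inner A (∑ i ∈ s, y i) x = ∑ i ∈ s, inner A (y i) x := by
  rw [← star_inner, inner_sum_right, star_sum]
  simp only [star_inner]

theorem isSelfAdjoint_inner_self (x : E) : IsSelfAdjoint (inner A x x) := star_inner x x

variable (A) in
theorem ext_inner_left {x y : E} (h : ∀ z : E, inner A z x = inner A z y) : x = y := by
  rw [← sub_eq_zero, ← inner_self_eq_zero (A := A), inner_sub_right, h, sub_self]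

variable (A) in
theorem norm_sq_eq (x : E) : ‖x‖ ^ 2 = ‖inner A x x‖ := by
  rw [norm_eq_sqrt_norm_inner_self (A := A), Real.sq_sqrt (norm_nonneg _)]

/-- Compatibility of the `ℂ`- and `A`-actions is not an axiom of the module; nondegeneracy of the
inner product forces it. -/
theorem op_smul_left_smul (a : A) (z : ℂ) (x : E) :
    MulOpposite.op (z • a) • x = z • MulOpposite.op a • x :=
  ext_inner_left A fun w ↦ by
    simp only [inner_op_smul_right, inner_smul_right, mul_smul_comm]

variable [StarOrderedRing A]

/-- The **Cauchy–Schwarz inequality**. -/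
theorem inner_mul_inner_swap_le (w x : E) :
    inner A x w * inner A w x ≤ ‖w‖ ^ 2 • inner A x x := by
  rcases eq_or_ne w 0 with rfl | hw
  · simp [inner_zero_left]
  set a := inner A w x with ha
  have hxa : inner A x w = star a := (star_inner w x).symm
  set q := ‖w‖ ^ 2 with hq
  have hq0 : 0 < q := by positivity
  have h0 := inner_self_nonneg (A := A) (q • x - MulOpposite.op a • w)
  have h1 : star a * inner A w w * a ≤ q • (star a * a) := by
    rw [hq, norm_sq_eq A]
    exact CStarAlgebra.star_left_conjugate_le_norm_smul (isSelfAdjoint_inner_self w)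
  have h2 : inner A (q • x - MulOpposite.op a • w) (q • x - MulOpposite.op a • w)
      = q • (q • inner A x x - star a * a)
        - (q • (star a * a) - star a * inner A w w * a) := by
    simp only [inner_sub_left, inner_sub_right, inner_smul_real_left, inner_smul_real_right,
      inner_op_smul_left, inner_op_smul_right, hxa, ← ha, smul_sub, sub_mul, smul_mul_assoc]
  rw [h2] at h0
  have h3 : 0 ≤ q • (q • inner A x x - star a * a) :=
    (sub_nonneg.2 h1).trans (sub_nonneg.1 h0)
  rw [hxa, ← sub_nonneg]
  have h4 := smul_nonneg (inv_pos.2 hq0).le h3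
  rwa [smul_smul, inv_mul_cancel₀ hq0.ne', one_smul] at h4

theorem norm_inner_le (w x : E) : ‖inner A w x‖ ≤ ‖w‖ * ‖x‖ := by
  have h0 : (0 : A) ≤ inner A x w * inner A w x := by
    rw [← star_inner w x]; exact star_mul_self_nonneg _
  have h := CStarAlgebra.norm_le_norm_of_nonneg_of_le h0 (inner_mul_inner_swap_le w x)
  rw [← star_inner w x, CStarRing.norm_star_mul_self, norm_smul, ← norm_sq_eq A x,
    Real.norm_of_nonneg (sq_nonneg _), ← mul_pow, ← pow_two] at h
  exact le_of_sq_le_sq h (by positivity)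

omit [StarOrderedRing A] in
theorem norm_op_smul_le (x : E) (a : A) : ‖MulOpposite.op a • x‖ ≤ ‖a‖ * ‖x‖ := by
  refine le_of_sq_le_sq ?_ (by positivity)
  rw [norm_sq_eq A, inner_op_smul_left, inner_op_smul_right, mul_pow, norm_sq_eq A x]
  calc _ ≤ ‖star a‖ * (‖inner A x x‖ * ‖a‖) :=
        (norm_mul_le _ _).trans (by gcongr; exact norm_mul_le _ _)
    _ = _ := by rw [norm_star]; ring

variable (A) in
/-- The operator `x ↦ v ⟪w, x⟫`. -/
noncomputable def rankOne {F : Type*} [NormedAddCommGroup F] [NormedSpace ℂ F] [Module Aᵐᵒᵖ F]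
    [HilbertCStarModule A F] (v : F) (w : E) : E →L[ℂ] F :=
  LinearMap.mkContinuous
    { toFun := fun x ↦ MulOpposite.op (inner A w x) • v
      map_add' := fun x y ↦ by rw [inner_add_right, MulOpposite.op_add, add_smul]
      map_smul' := fun z x ↦ by
        rw [inner_smul_right, op_smul_left_smul, RingHom.id_apply] }
    (‖w‖ * ‖v‖) fun x ↦ by
      refine (norm_op_smul_le v _).trans ?_
      calc _ ≤ ‖w‖ * ‖x‖ * ‖v‖ := by gcongr; exact norm_inner_le w x
        _ = _ := by ring

theorem rankOne_apply {F : Type*} [NormedAddCommGroup F] [NormedSpace ℂ F] [Module Aᵐᵒᵖ F]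
    [HilbertCStarModule A F] (v : F) (w x : E) :
    rankOne A v w x = MulOpposite.op (inner A w x) • v := rfl

/-- A bounded operator with `δ ⟪x, x⟫ ≤ ⟪x, V x⟫ ≤ W ⟪x, x⟫` for some `δ > 0` is onto. -/
theorem surjective_of_le_inner {V : E →L[ℂ] E} {δ W : ℝ} (hδ : 0 < δ)
    (hlow : ∀ x : E, δ • inner A x x ≤ inner A x (V x))
    (hup : ∀ x : E, inner A x (V x) ≤ W • inner A x x) : Function.Surjective V := by
  have : CompleteSpace E := complete (A := A)
  -- `V` is not assumed adjointable; `⟪x, V x⟫` is selfadjoint because it dominates `δ ⟪x, x⟫`.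
  have hsymm (x : E) : inner A (V x) x = inner A x (V x) := by
    rw [← star_inner]
    have h := (sub_nonneg.2 (hlow x)).isSelfAdjoint.add
      (IsSelfAdjoint.smul (IsSelfAdjoint.all δ) (isSelfAdjoint_inner_self (A := A) x))
    rw [sub_add_cancel] at h
    exact h
  set N := ‖V‖ ^ 2 + 1 with hN
  have hN0 : 0 < N := by positivity
  -- The aim is `‖1 - t V‖ < 1`. The first bound gives `t² ‖V‖² ≤ t δ`; the second gives `2 t W ≤
  -- 1`, so `⟪x, x⟫ - 2 t ⟪x, V x⟫` is positive and its norm can be compared.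
  set t := min (δ / N) (1 / (2 * (|W| + 1))) with ht
  have hW1 : 0 < |W| + 1 := by positivity
  have ht0 : 0 < t := lt_min (by positivity) (by positivity)
  have ht1 : t * N ≤ δ := (le_div_iff₀ hN0).1 (min_le_left _ _)
  have ht2 : t * (2 * (|W| + 1)) ≤ 1 := (le_div_iff₀ (by positivity)).1 (min_le_right _ _)
  have htW : 2 * t * W ≤ 1 := by
    nlinarith [le_abs_self W, mul_le_mul_of_nonneg_left (le_abs_self W) ht0.le]
  have hbound (x : E) : ‖x - t • V x‖ ^ 2 ≤ (1 - t * δ) * ‖x‖ ^ 2 := by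
    have hx := inner_self_nonneg (A := A) x
    have e : inner A (x - t • V x) (x - t • V x)
        = (inner A x x - (2 * t) • inner A x (V x)) + t ^ 2 • inner A (V x) (V x) := by
      simp only [inner_sub_left, inner_sub_right, inner_smul_real_left, inner_smul_real_right,
        hsymm, two_mul, add_smul, pow_two, smul_sub, smul_smul]
      abel
    have hpos : 0 ≤ inner A x x - (2 * t) • inner A x (V x) := by
      rw [sub_nonneg]
      calc (2 * t) • inner A x (V x) ≤ (2 * t) • W • inner A x x :=
            smul_le_smul_of_nonneg_left (hup x) (by positivity)
        _ = (2 * t * W) • inner A x x := smul_smul _ _ _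
        _ ≤ (1 : ℝ) • inner A x x := smul_le_smul_of_nonneg_right htW hx
        _ = inner A x x := one_smul _ _
    have hle : inner A x x - (2 * t) • inner A x (V x) ≤ (1 - 2 * t * δ) • inner A x x := by
      rw [sub_smul, one_smul, mul_smul (2 * t) δ]
      exact sub_le_sub_left (smul_le_smul_of_nonneg_left (hlow x) (by positivity)) _
    have hn := CStarAlgebra.norm_le_norm_of_nonneg_of_le hpos hle
    rcases eq_or_ne x 0 with rfl | hx0
    · simp
    have hxp : 0 < ‖x‖ ^ 2 := by positivity
    have hc : 0 ≤ 1 - 2 * t * δ := by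
      by_contra hc
      have h1 : (1 - 2 * t * δ) • inner A x x ≤ 0 :=
        smul_nonpos_of_nonpos_of_nonneg (not_le.1 hc).le hx
      have h2 : (1 - 2 * t * δ) • inner A x x = 0 := le_antisymm h1 (hpos.trans hle)
      rcases smul_eq_zero.1 h2 with h3 | h3
      · exact hc h3.ge
      · exact hx0 ((inner_self_eq_zero x).1 h3)
    rw [norm_smul, Real.norm_of_nonneg hc, ← norm_sq_eq A] at hn
    have hV : ‖V x‖ ^ 2 ≤ ‖V‖ ^ 2 * ‖x‖ ^ 2 := by
      rw [← mul_pow]; gcongr; exact V.le_opNorm x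
    calc ‖x - t • V x‖ ^ 2
        ≤ (1 - 2 * t * δ) * ‖x‖ ^ 2 + t ^ 2 * ‖V x‖ ^ 2 := by
          rw [norm_sq_eq A (x - t • V x), e]
          refine (norm_add_le _ _).trans (add_le_add hn ?_)
          rw [norm_smul, ← norm_sq_eq A, Real.norm_of_nonneg (sq_nonneg t)]
      _ ≤ (1 - 2 * t * δ) * ‖x‖ ^ 2 + t ^ 2 * (‖V‖ ^ 2 * ‖x‖ ^ 2) := by gcongr
      _ = (1 - 2 * t * δ + t * (t * ‖V‖ ^ 2)) * ‖x‖ ^ 2 := by ring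
      _ ≤ (1 - t * δ) * ‖x‖ ^ 2 := by
          gcongr
          nlinarith
  have hnorm : ‖(1 : E →L[ℂ] E) - (t : ℂ) • V‖ < 1 := by
    have hlt : √(1 - t * δ) < 1 := by
      rw [Real.sqrt_lt' one_pos]
      nlinarith [mul_pos ht0 hδ]
    refine lt_of_le_of_lt (ContinuousLinearMap.opNorm_le_bound _ (Real.sqrt_nonneg _)
      fun x ↦ ?_) hlt
    have h1 := Real.sqrt_le_sqrt (hbound x)
    rw [Real.sqrt_sq (norm_nonneg _), Real.sqrt_mul' _ (sq_nonneg _),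
      Real.sqrt_sq (norm_nonneg _)] at h1
    simpa using h1
  have hunit : IsUnit ((t : ℂ) • V) := by
    simpa using isUnit_one_sub_of_norm_lt_one hnorm
  intro x
  obtain ⟨y, hy⟩ := (ContinuousLinearMap.isUnit_iff_bijective.1 hunit).2 x
  exact ⟨(t : ℂ) • y, by rw [map_smul]; exact hy⟩

end Basic

end HilbertCStarModule

/-! ### Fibers of a module at a state. -/

namespace HilbertCStarModule

section States

variable {A E : Type*} [CStarAlgebra A] [PartialOrder A] [StarOrderedRing A]
  [NormedAddCommGroup E] [NormedSpace ℂ E] [Module Aᵐᵒᵖ E] [HilbertCStarModule A E]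
  {f : StrongDual ℂ A}

theorem state_inner_norm_sq_le (hf : f ∈ stateSpace A) (w x : E) :
    ‖f (inner A w x)‖ ^ 2 ≤ ‖w‖ ^ 2 * (f (inner A x x)).re := by
  have h1 := state_norm_sq_le hf (inner A w x)
  rw [star_inner] at h1
  have h2 := state_mono hf (inner_mul_inner_swap_le w x)
  rw [map_smul_real, Complex.re_ofReal_mul] at h2
  exact h1.trans h2

theorem state_inner_eq_zero (hf : f ∈ stateSpace A) (w : E) {x : E}
    (hx : (f (inner A x x)).re = 0) : f (inner A w x) = 0 := by
  have h := state_inner_norm_sq_le hf w x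
  rw [hx, mul_zero] at h
  simpa using le_antisymm h (sq_nonneg _)

omit [StarOrderedRing A] in
theorem state_inner_self_nonneg (hf : f ∈ stateSpace A) (x : E) : 0 ≤ (f (inner A x x)).re :=
  state_nonneg hf (inner_self_nonneg x)

variable (A E) in
/-- In a full module, finitely many vectors suffice to be nonzero in every state. -/
theorem IsFull.exists_finset (h : IsFull A E) :
    ∃ s : Finset (E × E), ∀ f ∈ stateSpace A, ∃ p ∈ s, 0 < (f (inner A p.2 p.2)).re := by
  -- A state killing all terms of a sum at distance less than `1` from the unit would give `1 = f 1
  -- < 1`.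
  obtain ⟨a, ha, hdist⟩ := Metric.mem_closure_iff.1 (h (1 : A)) 1 one_pos
  obtain ⟨l, rfl⟩ := (Finsupp.mem_span_range_iff_exists_finsupp).1 ha
  refine ⟨l.support, fun f hf ↦ ?_⟩
  by_contra! hcon
  have h0 : f (l.sum fun p z ↦ z • inner A p.1 p.2) = 0 := by
    rw [Finsupp.sum, map_sum]
    refine Finset.sum_eq_zero fun p hp ↦ ?_
    rw [map_smul, state_inner_eq_zero hf p.1
      (le_antisymm (hcon p hp) (state_inner_self_nonneg hf _)), smul_zero]
  have h1 : ‖f (1 - l.sum fun p z ↦ z • inner A p.1 p.2)‖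
      ≤ ‖f‖ * ‖1 - l.sum fun p z ↦ z • inner A p.1 p.2‖ := f.le_opNorm _
  rw [map_sub, h0, (mem_stateSpace_iff.1 hf).2, sub_zero, norm_one, hf.2, one_mul,
    ← dist_eq_norm] at h1
  linarith

variable (E) in
/-- The quotient of `E` by the null space of the semi-inner product `f ⟪·, ·⟫` has
dimension at most one. -/
def HasRankOneFiber (f : StrongDual ℂ A) : Prop :=
  ∀ u v : E, (f (inner A v v)).re ≠ 0 →
    ∃ μ : ℂ, (f (inner A (u - μ • v) (u - μ • v))).re = 0

/-- On a one-dimensional fiber, the Cauchy–Schwarz inequality is an equality. -/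
theorem HasRankOneFiber.le_norm_sq (hE : HasRankOneFiber E f) (hf : f ∈ stateSpace A) (w x : E) :
    (f (inner A w w)).re * (f (inner A x x)).re ≤ ‖f (inner A w x)‖ ^ 2 := by
  rcases eq_or_ne (f (inner A w w)).re 0 with hw | hw
  · rw [hw, zero_mul]
    positivity
  obtain ⟨μ, hμ⟩ := hE x w hw
  have h1 : f (inner A w x) = μ * f (inner A w w) := by
    have := state_inner_eq_zero hf w hμ
    rwa [inner_sub_right, inner_smul_right, map_sub, map_smul, smul_eq_mul, sub_eq_zero] at this
  have h2 : f (inner A x x) = μ * star (f (inner A w x)) := by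
    have := state_inner_eq_zero hf x hμ
    rwa [inner_sub_right, inner_smul_right, map_sub, map_smul, smul_eq_mul, sub_eq_zero,
      ← star_inner w x, state_map_star hf] at this
  have h3 : ((‖f (inner A w x)‖ ^ 2 : ℝ) : ℂ)
      = ((f (inner A w w)).re * (f (inner A x x)).re : ℝ) := by
    rw [Complex.ofReal_mul, state_ofReal_re hf (inner_self_nonneg w),
      state_ofReal_re hf (inner_self_nonneg x), h2, ← mul_assoc, mul_comm (f _) μ, ← h1,
      Complex.star_def, Complex.mul_conj, Complex.normSq_eq_norm_sq]
  exact (Complex.ofReal_injective h3).ge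

/-- If `f` attains the norm of a vector `y` of `F` whose fiber is one-dimensional, then any vector
of `E` that does not vanish at `f` can be moved by `⟪y, y⟫` to one on which `f` is dispersion
free. -/
theorem HasRankOneFiber.exists_modulus {F : Type*} [NormedAddCommGroup F] [NormedSpace ℂ F]
    [Module Aᵐᵒᵖ F] [HilbertCStarModule A F] (hF : HasRankOneFiber F f) (hf : f ∈ stateSpace A)
    {y : F} (hy0 : y ≠ 0) (hy : ‖inner A y y‖ ≤ (f (inner A y y)).re)
    {x : E} (hx : 0 < (f (inner A x x)).re) :
    ∃ x' : E, ∃ r : ℝ, 0 < r ∧ (f (modulus A x')).re = r ∧ (f (inner A x' x')).re = r ^ 2 := by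
  set h := inner A y y with hh
  set m := inner A x x with hm
  have hhsa : star h = h := star_inner y y
  have hmsa : star m = m := star_inner x x
  have hh0 : (0 : ℝ) < ‖h‖ := norm_pos_iff.2 fun h0 ↦ hy0 ((inner_self_eq_zero y).1 h0)
  have hmul (b : A) : f (b * h) = ‖h‖ * f b := by
    have hvar := state_variance_nonpos hf (inner_self_nonneg y) hy
    have hsa : star (h - algebraMap ℝ A ‖h‖) = h - algebraMap ℝ A ‖h‖ := by
      rw [star_sub, hhsa, (IsSelfAdjoint.algebraMap A (.all ‖h‖)).star_eq]
    have := state_apply_mul_eq_zero hf (k := h - algebraMap ℝ A ‖h‖) (by rwa [hsa]) b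
    rwa [mul_sub, ← Algebra.commutes, ← Algebra.smul_def, map_sub, map_smul_real,
      sub_eq_zero] at this
  have hfm : star (f m) = f m := by rw [← state_map_star hf, hmsa]
  -- Modulo null vectors `y m = μ y`, so `h m` also acts as a scalar under `f`. Hence so does `k = h
  -- m h = ⟪x h, x h⟫`, and `f` has zero variance at `k`.
  obtain ⟨μ, hμ⟩ := hF (MulOpposite.op m • y) y (by rw [← hh]; linarith)
  have hmul' (b : A) : f (b * h * m) = μ * (‖h‖ * f b) := by
    have := state_inner_eq_zero hf (MulOpposite.op (star b) • y) hμ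
    rw [inner_op_smul_left, star_star, inner_sub_right, inner_op_smul_right, inner_smul_right,
      ← hh, mul_sub, mul_smul_comm, map_sub, map_smul, sub_eq_zero, hmul, ← mul_assoc] at this
    exact this
  set k := h * m * h with hk
  set lam := ‖h‖ ^ 2 * (f m).re with hlam
  have hlam0 : 0 < lam := by positivity
  have hfk : f k = lam := by
    have e : f (h * m) = ‖h‖ * f m := by
      rw [← hhsa, ← hmsa, ← star_mul, state_map_star hf, hmul, hmsa, star_mul', hfm]
      simp
    have hre : ((f m).re : ℂ) = f m := state_ofReal_re hf (inner_self_nonneg x)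
    rw [hk, hmul, e, hlam, Complex.ofReal_mul, hre]
    push_cast
    ring
  have hmulk (b : A) : f (b * k) = lam * f b := by
    have e (b : A) : f (b * k) = (‖h‖ * (μ * ‖h‖)) * f b := by
      rw [hk, ← mul_assoc, ← mul_assoc, hmul, hmul']
      ring
    have e1 := e 1
    rw [one_mul, hfk, (mem_stateSpace_iff.1 hf).2, mul_one] at e1
    rw [e b, e1]
  have hk_eq : inner A (MulOpposite.op h • x) (MulOpposite.op h • x) = k := by
    rw [inner_op_smul_left, inner_op_smul_right, hhsa, hk, mul_assoc]
  have hk0 : 0 ≤ k := hk_eq ▸ inner_self_nonneg _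
  refine ⟨MulOpposite.op h • x, √lam, Real.sqrt_pos.2 hlam0, ?_, ?_⟩
  · rw [modulus, hk_eq]
    refine state_sqrt_re_eq hf hk0 (Real.sqrt_pos.2 hlam0) ?_
    rw [Real.sq_sqrt hlam0.le, mul_sub, ← Algebra.commutes, ← Algebra.smul_def, map_sub,
      map_smul_real, hmulk, sub_self, Complex.zero_re]
  · rw [hk_eq, hfk, Real.sq_sqrt hlam0.le, Complex.ofReal_re]

theorem state_inner_self_eq_zero_of_modulus {F : Type*} [NormedAddCommGroup F] [NormedSpace ℂ F]
    [Module Aᵐᵒᵖ F] [HilbertCStarModule A F] (hf : f ∈ stateSpace A) {c : ℝ} (hc : 0 < c)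
    {x : E} {y : F} (h : c * (f (modulus A x)).re * (f (modulus A y)).re ≤ 0) :
    (f (inner A x x)).re = 0 ∨ (f (inner A y y)).re = 0 := by
  by_contra! hcon
  have hx : 0 < (f (modulus A x)).re := lt_of_not_ge fun hle ↦
    hcon.1 (state_eq_zero_of_sqrt_nonpos hf (inner_self_nonneg x) hle)
  have hy : 0 < (f (modulus A y)).re := lt_of_not_ge fun hle ↦
    hcon.2 (state_eq_zero_of_sqrt_nonpos hf (inner_self_nonneg y) hle)
  exact absurd h (not_le.2 (by positivity))

end States

/-! ### Consequences of the lower bound on the form. -/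

section Forms

variable {A X Y : Type*} [CStarAlgebra A] [PartialOrder A] [StarOrderedRing A]
  [NormedAddCommGroup X] [NormedSpace ℂ X] [Module Aᵐᵒᵖ X] [HilbertCStarModule A X]
  [NormedAddCommGroup Y] [NormedSpace ℂ Y] [Module Aᵐᵒᵖ Y] [HilbertCStarModule A Y]
  {B : X →L⋆[ℂ] Y →L[ℂ] A} {c : ℝ}

/-- A form bounded below at `f` has one-dimensional fibers at `f` in the second variable. -/
theorem hasRankOneFiber_right (hX : IsFull A X) (hc : 0 < c) {f : StrongDual ℂ A}
    (hf : f ∈ stateSpace A)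
    (hB : ∀ (x : X) (y : Y), c * (f (modulus A x)).re * (f (modulus A y)).re ≤ ‖f (B x y)‖) :
    HasRankOneFiber Y f := by
  intro u v hv
  obtain ⟨s, hs⟩ := hX.exists_finset
  obtain ⟨p, -, hp⟩ := hs f hf
  have hzero {y : Y} (hy : f (B p.2 y) = 0) : (f (inner A y y)).re = 0 :=
    (state_inner_self_eq_zero_of_modulus hf hc
      ((hB p.2 y).trans_eq (by rw [hy, norm_zero]))).resolve_left hp.ne'
  have hv' : f (B p.2 v) ≠ 0 := fun h ↦ hv (hzero h)
  -- This scalar makes `f (B p.2 (u - μ v))` vanish.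
  refine ⟨f (B p.2 u) / f (B p.2 v), hzero ?_⟩
  rw [map_sub, map_smul, map_sub, map_smul, smul_eq_mul, div_mul_cancel₀ _ hv', sub_self]

/-- A form bounded below at `f` has one-dimensional fibers at `f` in the first variable. -/
theorem hasRankOneFiber_left (hY : IsFull A Y) (hc : 0 < c) {f : StrongDual ℂ A}
    (hf : f ∈ stateSpace A)
    (hB : ∀ (x : X) (y : Y), c * (f (modulus A x)).re * (f (modulus A y)).re ≤ ‖f (B x y)‖) :
    HasRankOneFiber X f := by
  intro u v hv
  obtain ⟨s, hs⟩ := hY.exists_finset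
  obtain ⟨p, -, hp⟩ := hs f hf
  have hzero {x : X} (hx : f (B x p.2) = 0) : (f (inner A x x)).re = 0 :=
    (state_inner_self_eq_zero_of_modulus hf hc
      ((hB x p.2).trans_eq (by rw [hx, norm_zero]))).resolve_right hp.ne'
  have hv' : f (B v p.2) ≠ 0 := fun h ↦ hv (hzero h)
  refine ⟨star (f (B u p.2) / f (B v p.2)), hzero ?_⟩
  rw [map_sub, map_smulₛₗ, sub_apply, smul_apply, map_sub,
    map_smul, smul_eq_mul, Complex.star_def, Complex.conj_conj, div_mul_cancel₀ _ hv', sub_self]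

/-- The vectors representing a form that is bounded below at all pure states are bounded below. -/
theorem mul_norm_le_of_inner_eq [Nontrivial A] (hX : IsFull A X) (hc : 0 < c)
    (hB : ∀ f ∈ pureStates A, ∀ (x : X) (y : Y),
      c * (f (modulus A x)).re * (f (modulus A y)).re ≤ ‖f (B x y)‖)
    {y : Y} {z : X} (hz : ∀ x : X, B x y = inner A x z) : c * ‖y‖ ≤ ‖z‖ := by
  rcases eq_or_ne y 0 with rfl | hy0
  · simp
  obtain ⟨f, hfp, hfy⟩ := exists_mem_pureStates_norm_le (inner_self_nonneg (A := A) y)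
  have hf := hfp.1
  obtain ⟨s, hs⟩ := hX.exists_finset
  obtain ⟨p, -, hp⟩ := hs f hf
  -- In general `f |x|` may be smaller than `(f ⟪x, x⟫)^(1/2)`. Here both equal `r`, so `r` cancels
  -- in `c r ‖y‖ ≤ |f ⟪z, x⟫| ≤ ‖z‖ r`.
  obtain ⟨x, r, hr, hmod, hinner⟩ :=
    (hasRankOneFiber_right hX hc hf (hB f hfp)).exists_modulus hf hy0 hfy hp
  have hmody : (f (modulus A y)).re = ‖y‖ :=
    state_sqrt_re_eq hf (inner_self_nonneg y) (norm_pos_iff.2 hy0) (by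
      rw [norm_sq_eq A]
      exact state_variance_nonpos hf (inner_self_nonneg y) hfy)
  have h1 := hB f hfp x y
  rw [hmod, hmody, hz, ← star_inner z x, state_map_star hf, norm_star] at h1
  have h2 := state_inner_norm_sq_le hf z x
  rw [hinner, ← mul_pow] at h2
  have h3 := h1.trans (le_of_sq_le_sq h2 (by positivity))
  nlinarith

end Forms

end HilbertCStarModule

/-! ### Frame operators. -/

namespace HilbertCStarModule

section FrameOperator

variable {A E ι : Type*} [CStarAlgebra A] [PartialOrder A] [StarOrderedRing A]
  [NormedAddCommGroup E] [NormedSpace ℂ E] [Module Aᵐᵒᵖ E] [HilbertCStarModule A E]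

variable (A) in
/-- The operator `x ↦ ∑ i ∈ s, w i ⟪w i, x⟫`. -/
noncomputable def frameOperator (s : Finset ι) (w : ι → E) : E →L[ℂ] E :=
  ∑ i ∈ s, rankOne A (w i) (w i)

theorem frameOperator_apply (s : Finset ι) (w : ι → E) (x : E) :
    frameOperator A s w x = ∑ i ∈ s, MulOpposite.op (inner A (w i) x) • w i := by
  simp [frameOperator, rankOne_apply]

theorem inner_frameOperator (s : Finset ι) (w : ι → E) (x z : E) :
    inner A x (frameOperator A s w z) = ∑ i ∈ s, inner A x (w i) * inner A (w i) z := by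
  simp only [frameOperator_apply, inner_sum_right, inner_op_smul_right]

theorem frameOperator_inner (s : Finset ι) (w : ι → E) (x z : E) :
    inner A (frameOperator A s w x) z = inner A x (frameOperator A s w z) := by
  rw [inner_frameOperator, frameOperator_apply, inner_sum_left]
  simp only [inner_op_smul_left, star_inner]

/-- If all fibers over pure states are one-dimensional, a finite family that vanishes at no pure
state has a surjective frame operator. -/
theorem frameOperator_surjective [Nontrivial A] (s : Finset ι) (w : ι → E)
    (hE : ∀ f ∈ pureStates A, HasRankOneFiber E f)
    (hw : ∀ f ∈ pureStates A, ∃ i ∈ s, 0 < (f (inner A (w i) (w i))).re) :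
    Function.Surjective (frameOperator A s w) := by
  have hpos (i : ι) (x : E) : 0 ≤ inner A x (w i) * inner A (w i) x := by
    rw [← star_inner (w i) x]
    exact star_mul_self_nonneg _
  -- The value at a minimizing pure state is a uniform lower bound, positive because the family does
  -- not vanish there.
  obtain ⟨f₀, hf₀, hle₀⟩ := exists_mem_pureStates_algebraMap_le
    (IsSelfAdjoint.of_nonneg (Finset.sum_nonneg fun i (_ : i ∈ s) ↦
      inner_self_nonneg (A := A) (w i)))
  set δ := (f₀ (∑ i ∈ s, inner A (w i) (w i))).re with hδ
  have hδ0 : 0 < δ := by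
    rw [hδ, map_sum, Complex.re_sum]
    obtain ⟨i, hi, hlt⟩ := hw f₀ hf₀
    exact Finset.sum_pos' (fun j _ ↦ state_inner_self_nonneg hf₀.1 _) ⟨i, hi, hlt⟩
  refine surjective_of_le_inner (A := A) (δ := δ) (W := ∑ i ∈ s, ‖w i‖ ^ 2) hδ0
    (fun x ↦ ?_) fun x ↦ ?_
  · rw [inner_frameOperator, ← sub_nonneg]
    -- At a pure state, `f ⟪w, w⟫ f ⟪x, x⟫ ≤ |f ⟪w, x⟫|² ≤ f (⟪x, w⟫ ⟪w, x⟫)`; sum over the family.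
    refine nonneg_of_pureStates ?_ fun f hf ↦ ?_
    · exact (IsSelfAdjoint.of_nonneg (Finset.sum_nonneg fun i _ ↦ hpos i x)).sub
        (IsSelfAdjoint.smul (IsSelfAdjoint.all δ) (isSelfAdjoint_inner_self x))
    have h1 := state_mono hf.1 hle₀
    rw [state_apply_algebraMap hf.1, Complex.ofReal_re, map_sum, Complex.re_sum] at h1
    rw [map_sub, Complex.sub_re, map_smul_real, Complex.re_ofReal_mul, map_sum, Complex.re_sum,
      sub_nonneg]
    calc δ * (f (inner A x x)).re
        ≤ (∑ i ∈ s, (f (inner A (w i) (w i))).re) * (f (inner A x x)).re :=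
          mul_le_mul_of_nonneg_right h1 (state_inner_self_nonneg hf.1 x)
      _ = ∑ i ∈ s, (f (inner A (w i) (w i))).re * (f (inner A x x)).re := Finset.sum_mul _ _ _
      _ ≤ _ := Finset.sum_le_sum fun i _ ↦ by
          refine ((hE f hf).le_norm_sq hf.1 (w i) x).trans ?_
          rw [← star_inner (w i) x]
          exact state_norm_sq_le hf.1 _
  · rw [inner_frameOperator, Finset.sum_smul]
    exact Finset.sum_le_sum fun i _ ↦ inner_mul_inner_swap_le (w i) x

end FrameOperator

/-! ### The representing vector. -/

/-- **Lax–Milgram** for forms bounded below at all pure states: every bounded module map is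
represented by a unique vector. -/
theorem existsUnique_representing_vector {A X Y : Type*}
    [CStarAlgebra A] [PartialOrder A] [StarOrderedRing A]
    [NormedAddCommGroup X] [NormedSpace ℂ X] [Module Aᵐᵒᵖ X] [HilbertCStarModule A X]
    [NormedAddCommGroup Y] [NormedSpace ℂ Y] [Module Aᵐᵒᵖ Y] [HilbertCStarModule A Y]
    (hX : IsFull A X) (hY : IsFull A Y) (hXdual : IsSelfDual A X)
    {B : X →L⋆[ℂ] Y →L[ℂ] A}
    (hBX : ∀ (x : X) (y : Y) (a : A), B (MulOpposite.op a • x) y = star a * B x y)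
    (hBY : ∀ (x : X) (y : Y) (a : A), B x (MulOpposite.op a • y) = B x y * a)
    {c : ℝ} (hc : 0 < c)
    (hB : ∀ f ∈ pureStates A, ∀ (x : X) (y : Y),
      c * (f (modulus A x)).re * (f (modulus A y)).re ≤ ‖f (B x y)‖)
    {τ : Y →L[ℂ] A} (hτ : τ ∈ dual A Y) :
    ∃ x : X, ‖x‖ ≤ ‖τ‖ / c ∧ (∀ y : Y, B x y = τ y) ∧
      ∀ x' : X, (∀ y : Y, B x' y = τ y) → x' = x := by
  rcases subsingleton_or_nontrivial A with hA | hA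
  · have hX0 (x : X) : x = 0 := (inner_self_eq_zero (A := A) x).1 (Subsingleton.elim _ _)
    exact ⟨0, by rw [norm_zero]; positivity, fun y ↦ Subsingleton.elim _ _, fun x _ ↦ hX0 x⟩
  -- the operator `S` with `B x y = ⟪x, S y⟫`
  have hS (y : Y) : ∃ z : X, ∀ x : X, B x y = inner A x z := by
    let φ : X →L[ℂ] A := LinearMap.mkContinuous
      { toFun := fun x ↦ star (B x y)
        map_add' := fun x₁ x₂ ↦ by simp
        map_smul' := fun z x ↦ by simp }
      (‖B‖ * ‖y‖) fun x ↦ by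
        change ‖star (B x y)‖ ≤ _
        rw [norm_star]
        exact (B.le_opNorm₂ x y).trans_eq (by ring)
    obtain ⟨z, hz⟩ := hXdual φ fun x a ↦ by
      change star (B (MulOpposite.op a • x) y) = star (B x y) * a
      rw [hBX, star_mul, star_star]
    refine ⟨z, fun x ↦ ?_⟩
    rw [← star_inner z x, ← hz x]
    exact (star_star _).symm
  choose S hS using hS
  have hlow {y : Y} {z : X} (hz : ∀ x : X, B x y = inner A x z) : c * ‖y‖ ≤ ‖z‖ :=
    mul_norm_le_of_inner_eq hX hc hB hz
  have hSinj {y₁ y₂ : Y} (h : S y₁ = S y₂) : y₁ = y₂ := by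
    have h0 : c * ‖y₁ - y₂‖ ≤ ‖(0 : X)‖ := hlow fun x ↦ by
      rw [map_sub, hS, hS, h, sub_self, inner_zero_right]
    rw [norm_zero] at h0
    rw [← sub_eq_zero, ← norm_le_zero_iff]
    exact nonpos_of_mul_nonpos_right h0 hc
  obtain ⟨s, hs⟩ := hY.exists_finset
  obtain ⟨sX, hsX⟩ := hX.exists_finset
  let w : Y × Y → X := fun p ↦ S p.2
  have hV : Function.Surjective (frameOperator A s w) := by
    refine frameOperator_surjective s w
      (fun f hf ↦ hasRankOneFiber_left hY hc hf.1 (hB f hf)) fun f hf ↦ ?_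
    obtain ⟨p, hp, hpos⟩ := hs f hf.1
    obtain ⟨q, -, hq⟩ := hsX f hf.1
    refine ⟨p, hp, lt_of_le_of_ne (state_inner_self_nonneg hf.1 _) fun h0 ↦ ?_⟩
    have hzero : f (B q.2 p.2) = 0 := by
      rw [hS]
      exact state_inner_eq_zero hf.1 _ h0.symm
    rcases state_inner_self_eq_zero_of_modulus hf.1 hc
      ((hB f hf q.2 p.2).trans_eq (by rw [hzero, norm_zero])) with h | h
    · exact hq.ne' h
    · exact hpos.ne' h
  -- `A`-linearity of `B` in `y` pulls the coefficients inside `S`, so the range of the frame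
  -- operator lies in that of `S`.
  have hVS (u : X) :
      frameOperator A s w u = S (∑ p ∈ s, MulOpposite.op (inner A (w p) u) • p.2) := by
    refine ext_inner_left A fun x ↦ ?_
    rw [← hS, inner_frameOperator, map_sum]
    simp only [hBY, hS, w]
  have hSsurj (z : X) : ∃ y, S y = z := by
    obtain ⟨u, rfl⟩ := hV z
    exact ⟨_, (hVS u).symm⟩
  -- Chosen so that `⟪V x₀, u⟫ = τ (∑ y_p ⟪w_p, u⟫)`. When `V u = S y`, injectivity of `S`
  -- identifies this sum with `y`, and symmetry of `V` gives `⟪x₀, S y⟫ = τ y`.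
  obtain ⟨x₀, hx₀⟩ := hV (∑ p ∈ s, MulOpposite.op (star (τ p.2)) • w p)
  have hrep (y : Y) : B x₀ y = τ y := by
    obtain ⟨u, hu⟩ := hV (S y)
    have hy := hSinj ((hVS u).symm.trans hu)
    rw [hS, ← hu, ← frameOperator_inner, hx₀, inner_sum_left, ← hy, map_sum]
    refine Finset.sum_congr rfl fun p _ ↦ ?_
    rw [inner_op_smul_left, star_star, hτ]
  refine ⟨x₀, ?_, hrep, fun x' hx' ↦ ?_⟩
  -- Writing `x₀ = S y` gives `⟪x₀, x₀⟫ = B x₀ y = τ y`, and `‖y‖ ≤ ‖x₀‖ / c`.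
  · obtain ⟨y, hy⟩ := hSsurj x₀
    have h1 : ‖x₀‖ ^ 2 ≤ ‖τ‖ * ‖y‖ := by
      rw [norm_sq_eq A]
      nth_rewrite 2 [← hy]
      rw [← hS, hrep]
      exact τ.le_opNorm y
    have h2 : c * ‖y‖ ≤ ‖x₀‖ := hlow fun x ↦ by rw [hS, hy]
    rw [le_div_iff₀ hc]
    rcases eq_or_ne x₀ 0 with h0 | h0
    · rw [h0, norm_zero, zero_mul]
      positivity
    have hx0 : 0 < ‖x₀‖ := norm_pos_iff.2 h0
    refine le_of_mul_le_mul_right ?_ hx0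
    calc ‖x₀‖ * c * ‖x₀‖ = c * ‖x₀‖ ^ 2 := by ring
      _ ≤ c * (‖τ‖ * ‖y‖) := by gcongr
      _ = ‖τ‖ * (c * ‖y‖) := by ring
      _ ≤ ‖τ‖ * ‖x₀‖ := by gcongr
  · rw [← sub_eq_zero, ← inner_self_eq_zero (A := A)]
    obtain ⟨y, hy⟩ := hSsurj (x' - x₀)
    nth_rewrite 2 [← hy]
    rw [← hS, map_sub, sub_apply, hx', hrep, sub_self]

end HilbertCStarModule

theorem corollary2p3 {A X Y : Type*}
    [CStarAlgebra A] [PartialOrder A] [StarOrderedRing A] [WStarAlgebra A]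
    [NormedAddCommGroup X] [NormedSpace ℂ X] [Module Aᵐᵒᵖ X] [HilbertCStarModule A X]
    [NormedAddCommGroup Y] [NormedSpace ℂ Y] [Module Aᵐᵒᵖ Y] [HilbertCStarModule A Y]
    (hX : HilbertCStarModule.IsFull A X) (hY : HilbertCStarModule.IsFull A Y)
    (hXdual : HilbertCStarModule.IsSelfDual A X)
    -- a bounded form, conjugate linear on `X` and linear on `Y`, over `ℂ` and over `A`
    (B : X →L⋆[ℂ] Y →L[ℂ] A)
    (hBX : ∀ (x : X) (y : Y) (a : A), B (MulOpposite.op a • x) y = star a * B x y)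
    (hBY : ∀ (x : X) (y : Y) (a : A), B x (MulOpposite.op a • y) = B x y * a)
    (c : ℝ) (hc : 0 < c)
    (hB : ∀ f ∈ pureStates A, ∀ (x : X) (y : Y),
      c * (f (HilbertCStarModule.modulus A x)).re * (f (HilbertCStarModule.modulus A y)).re
        ≤ ‖f (B x y)‖)
    (τ : Y →L[ℂ] A) (hτ : τ ∈ HilbertCStarModule.dual A Y) :
    ∃ x : X, ‖x‖ ≤ ‖τ‖ / c ∧ (∀ y : Y, B x y = τ y) ∧
      ∀ x' : X, (∀ y : Y, B x' y = τ y) → x' = x :=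
  HilbertCStarModule.existsUnique_representing_vector hX hY hXdual hBX hBY hc hB hτ
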